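/- For a finite or infinite graph $G$, write $d_G(u,v)\in\{0,1,2,\dots\}\cup\{\infty\}$ for the distance between $u,v\in V(G)$. A connected subgraph $C$ of $G$ is *geodesic* if $d_C(u,v)=d_G(u,v)$ for all $u,v\in V(C)$. A *tree-decomposition* of $G$ is a pair $(T,(B_t)_{t\in V(T)})$, where $T$ is a (possibly infinite) tree and each $B_t\subseteq V(G)$, such that every vertex of $G$ lies in some $B_t$, both ends of each edge of $G$ lie in some common $B_t$, and $B_{t_1}\cap B_{t_3}\subseteq B_{t_2}$ whenever $t_2$ lies on the path of $T$ between $t_1$ and $t_3$. Its *outer diameter* is $\sup_{t\in V(T)}\sup_{u,v\in B_t} d_G(u,v)$, and $\operatorname{odw}(G)$ (the outer diameter-width, or *tree-length*, of $G$) is the minimum outer diameter of a tree-decomposition of $G$. For an integer $n\ge 0$, let $G_n$ be the graph whose vertices are the triples $(a,b,c)$ of nonnegative integers with $a+b+c=n$, where $(a,b,c)$ and $(a',b',c')$ are adjacent if $|a-a'|+|b-b'|+|c-c'|=2$. **Theorem.** 1. For every $n\ge 0$, the graph $G_n$ is finite, every geodesic cycle of $G_n$ has length three, and $\operatorname{odw}(G_n)\ge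 n/3$. 2. Consequently, for every $k$ there is a finite graph $G$ with $\operatorname{odw}(G)\ge k$ in which every geodesic cycle has length three. 3. Consequently, there is no function $f:\mathbb{N}\to\mathbb{N}$ such that, for every finite graph $G$ and every $\ell\in\mathbb{N}$, if all geodesic cycles of $G$ have length at most $\ell$ then $\operatorname{odw}(G)\le f(\ell)$. -/

import Mathlib

namespace TreeLength

universe u

/-- A tree-decomposition of `G` whose tree has node set `N` (possibly infinite). -/
structure TreeDecomposition {V : Type u} (G : SimpleGraph V) (N : Type u) where
  /-- the tree -/
  tree : SimpleGraph N
  isTree : tree.IsTree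
  /-- the bags, arbitrary sets of vertices -/
  bag : N → Set V
  vertex_covered : ∀ v : V, ∃ t : N, v ∈ bag t
  edge_covered : ∀ v w : V, G.Adj v w → ∃ t : N, v ∈ bag t ∧ w ∈ bag t
  path_condition : ∀ (t₁ t₂ t₃ : N) (p : tree.Walk t₁ t₃), p.IsPath → t₂ ∈ p.support →
    bag t₁ ∩ bag t₃ ⊆ bag t₂

/-- The outer diameter: the largest distance in `G` (not in the bag) between two vertices of a
common bag, `⊤` if there is no largest one or if it is infinite. -/
noncomputable def TreeDecomposition.outerDiam {V : Type u} {G : SimpleGraph V} {N : Type u}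
    (B : TreeDecomposition G N) : ℕ∞ :=
  ⨆ t : N, ⨆ v ∈ B.bag t, ⨆ w ∈ B.bag t, G.edist v w

/-- The outer diameter-width, or tree-length: the minimum of the outer diameter over all
tree-decompositions of `G`. Node sets in the universe of `V` suffice: every tree-decomposition
can be restricted to a subtree with at most `max |V| ℵ₀` nodes. -/
noncomputable def odw {V : Type u} (G : SimpleGraph V) : ℕ∞ :=
  ⨅ (N : Type u) (B : TreeDecomposition G N), B.outerDiam

/-- A connected subgraph is geodesic if distances in it agree with distances in `G`. -/
def IsGeodesic {V : Type u} {G : SimpleGraph V} (C : G.Subgraph) : Prop :=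
  C.Connected ∧ ∀ v w : C.verts, C.coe.edist v w = G.edist (v : V) (w : V)

/-- The closed walk `c` runs once around a cycle of `G`, and that cycle (the subgraph formed by
its vertices and edges) is geodesic. Its number of edges is `c.length`. -/
def IsGeodesicCycle {V : Type u} {G : SimpleGraph V} {v : V} (c : G.Walk v v) : Prop :=
  c.IsCycle ∧ IsGeodesic c.toSubgraph

/-- Triples of nonnegative integers with sum `n`. -/
abbrev TriVertex (n : ℕ) : Type :=
  {p : ℕ × ℕ × ℕ // p.1 + p.2.1 + p.2.2 = n}

/-- The triangular piece, of side length `n`, of the triangular lattice: `(a, b, c)` and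
`(a', b', c')` are adjacent if `|a - a'| + |b - b'| + |c - c'| = 2`. -/
def triGraph (n : ℕ) : SimpleGraph (TriVertex n) where
  Adj p q := |(p.1.1 : ℤ) - q.1.1| + |(p.1.2.1 : ℤ) - q.1.2.1| + |(p.1.2.2 : ℤ) - q.1.2.2| = 2
  symm := ⟨fun p q h => by
    rw [abs_sub_comm (q.1.1 : ℤ), abs_sub_comm (q.1.2.1 : ℤ), abs_sub_comm (q.1.2.2 : ℤ)]
    exact h⟩
  loopless := ⟨fun p h => by simp at h⟩

end TreeLength

/-! Distance in `triGraph n` is the largest coordinate difference. On a geodesic cycle of length `L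
≥ 4`, put `k = L / 2`. Vertices `0` and `k` differ by `k` in some coordinate, which, up to sign,
rises at every step between them. The pairs `1`, `k + 1` and `L - 1`, `k - 1` are also at distance
`k`; this forces the coordinate not to fall just after `k` and not to rise when going back from `0`
to `L - 1`. At most `k - 1` steps are left for a fall by `k`, which is absurd
(`not_geodesic_closed_of_increase`).

For tree-length, take tree nodes whose bags contain the three corners. The bag at their median meets
all three sides (`exists_bag_meeting_sides`). Its vertex on one side has another coordinate of at
least `n / 2`, so it is that far from the bag's vertex on the side where that coordinate vanishes.
-/

namespace TreeLength

universe u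

open SimpleGraph

/-! ### Distance bounds, cycles, and medians in trees -/

section Graphs

variable {V : Type*} {G : SimpleGraph V}

/-- An integer function that changes by at most one along every edge changes by at most the
length of a walk between the ends of that walk. -/
theorem abs_sub_le_length {f : V → ℤ} (hf : ∀ u v, G.Adj u v → |f u - f v| ≤ 1)
    {u v : V} (p : G.Walk u v) : |f u - f v| ≤ p.length := by
  induction p with
  | nil => simp
  | @cons a b c h p ih =>
    have h1 := hf _ _ h
    have h2 := abs_sub_le (f a) (f b) (f c)
    rw [Walk.length_cons]
    push_cast
    linarith

/-- An integer function that changes by at most one along every edge bounds distances from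
below. -/
theorem le_edist_of_le_abs_sub {f : V → ℤ} (hf : ∀ u v, G.Adj u v → |f u - f v| ≤ 1)
    {u v : V} {k : ℕ} (hk : (k : ℤ) ≤ |f u - f v|) : (k : ℕ∞) ≤ G.edist u v := by
  by_cases h : G.edist u v = ⊤
  · simp [h]
  · obtain ⟨p, hp⟩ := exists_walk_of_edist_ne_top h
    have := abs_sub_le_length hf p
    rw [← hp]
    exact_mod_cast hk.trans this

/-- A sequence of consecutively adjacent vertices spans a walk. -/
theorem exists_walk_of_adj_succ (x : ℕ → V) (n : ℕ) (h : ∀ i < n, G.Adj (x i) (x (i + 1))) :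
    ∃ p : G.Walk (x 0) (x n), ∀ v ∈ p.support, ∃ i ≤ n, v = x i := by
  induction n with
  | zero => exact ⟨.nil, fun v hv => ⟨0, le_rfl, by simpa using hv⟩⟩
  | succ n ih =>
    obtain ⟨p, hp⟩ := ih fun i hi => h i (by omega)
    refine ⟨p.concat (h n (by omega)), fun v hv => ?_⟩
    rw [Walk.support_concat, List.mem_append, List.mem_singleton] at hv
    rcases hv with hv | rfl
    · obtain ⟨i, hi, rfl⟩ := hp v hv
      exact ⟨i, by omega, rfl⟩
    · exact ⟨n + 1, le_rfl, rfl⟩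

/-- Vertices at positions `i ≤ j` of a cycle of length `L` have distance at least
`min (j - i) (L - (j - i))` in the cycle. -/
theorem le_edist_toSubgraph_of_isCycle {v : V} {c : G.Walk v v} (hc : c.IsCycle)
    {i j k : ℕ} (hj : j < c.length) (hk : k ≤ j - i) (hk' : k + j ≤ c.length + i) (hij : i ≤ j)
    (hvi : c.getVert i ∈ c.toSubgraph.verts) (hvj : c.getVert j ∈ c.toSubgraph.verts) :
    (k : ℕ∞) ≤ c.toSubgraph.coe.edist ⟨c.getVert i, hvi⟩ ⟨c.getVert j, hvj⟩ := by
  have hex : ∀ u : c.toSubgraph.verts, ∃ m < c.length, c.getVert m = u := by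
    rintro ⟨u, hu⟩
    rw [Walk.mem_verts_toSubgraph, Walk.mem_support_iff_exists_getVert] at hu
    obtain ⟨m, hm, hmc⟩ := hu
    rcases hmc.lt_or_eq with h | rfl
    · exact ⟨m, h, hm⟩
    · exact ⟨0, by omega, by simpa using hm⟩
  choose pos hpos hget using hex
  have hinj : ∀ (u : c.toSubgraph.verts) (m : ℕ), m < c.length → c.getVert m = u → pos u = m := by
    intro u m hm hmu
    refine hc.getVert_injOn' ?_ ?_ ((hget u).trans hmu.symm)
    · have := hpos u
      simp only [Set.mem_ofPred_eq]
      omega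
    · simp only [Set.mem_ofPred_eq]
      omega
  have hstep : ∀ (u w : c.toSubgraph.verts) (m : ℕ), m < c.length → c.getVert m = u →
      c.getVert (m + 1) = w → pos u = m ∧ (pos w = m + 1 ∨ (pos w = 0 ∧ m + 1 = c.length)) := by
    intro u w m hm hu hw
    refine ⟨hinj u m hm hu, ?_⟩
    rcases Nat.lt_or_ge (m + 1) c.length with h | h
    · exact .inl (hinj w _ h hw)
    · have hm1 : m + 1 = c.length := by omega
      refine .inr ⟨hinj w 0 (by omega) ?_, hm1⟩
      rw [← hw, hm1]
      simp
  -- The cyclic distance to position `i` changes by at most one along each edge, including the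
  -- closing edge.
  refine le_edist_of_le_abs_sub
    (f := fun u => min |(pos u : ℤ) - i| (c.length - |(pos u : ℤ) - i|)) ?_ ?_
  · rintro u w huw
    rw [Subgraph.coe_adj, Walk.toSubgraph_adj_iff] at huw
    obtain ⟨m, hm, hmc⟩ := huw
    have := hpos u
    have := hpos w
    rw [Sym2.eq_iff] at hm
    rcases hm with ⟨h1, h2⟩ | ⟨h1, h2⟩
    · have := hstep u w m hmc h1 h2
      grind
    · have := hstep w u m hmc h1 h2
      grind
  · have h1 := hinj ⟨_, hvi⟩ i (by omega) rfl
    have h2 := hinj ⟨_, hvj⟩ j hj rfl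
    simp only [h1, h2, abs_eq_max_neg]
    omega

/-- In a tree, every walk contains the vertices of the path between its ends. -/
theorem support_subset_of_isPath (hG : G.IsTree) {s t : V} {p : G.Walk s t} (hp : p.IsPath)
    (q : G.Walk s t) : p.support ⊆ q.support := by
  classical
  have h : p = q.bypass := (hG.existsUnique_path s t).unique hp q.bypass_isPath
  rw [h]
  exact q.support_bypass_subset_support

/-- Any three vertices of a tree have a median: a vertex on every walk between two of them. -/
theorem exists_median (hG : G.IsTree) (a b c : V) :
    ∃ m, (∀ p : G.Walk a b, m ∈ p.support) ∧ (∀ p : G.Walk b c, m ∈ p.support) ∧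
      ∀ p : G.Walk c a, m ∈ p.support := by
  classical
  obtain ⟨r, hr, -⟩ := hG.existsUnique_path a c
  obtain ⟨m, hm, hmin⟩ := r.support.toFinset.exists_min_image (fun x => G.dist x b)
    ⟨a, by simp⟩
  simp only [List.mem_toFinset] at hm hmin
  obtain ⟨q, hqp, hq⟩ := hG.connected.exists_path_of_dist m b
  -- As `m` is a vertex of `r` nearest to `b`, the path `q` leaves `r` at once; hence either half of
  -- `r` followed by `q` is a path.
  have hdisj : ∀ x ∈ r.support, x ∉ q.support.tail := by
    intro x hx hxq
    have h1 := hmin x hx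
    cases q with
    | nil => simp at hxq
    | cons h q =>
      rw [Walk.support_cons, List.tail_cons] at hxq
      have h2 := dist_le (q.dropUntil x hxq)
      have h3 := q.length_dropUntil_le_length hxq
      rw [Walk.length_cons] at hq
      omega
  have key : ∀ (s : V) (p : G.Walk s m), p.IsPath → p.support ⊆ r.support →
      ∀ w : G.Walk s b, m ∈ w.support := by
    intro s p hp hpr w
    have hpath : (p.append q).IsPath := by
      rw [Walk.isPath_def, Walk.support_append, List.nodup_append']
      exact ⟨hp.support_nodup, hqp.support_nodup.tail, fun x hx => hdisj x (hpr hx)⟩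
    apply support_subset_of_isPath hG hpath w
    simp
  refine ⟨m, key a (r.takeUntil m hm) (hr.takeUntil hm) (r.support_takeUntil_subset_support hm),
    fun p => ?_, fun p => ?_⟩
  · have := key c (r.dropUntil m hm).reverse (hr.dropUntil hm).reverse (by
      rw [Walk.support_reverse]
      exact fun x hx => r.support_dropUntil_subset_support hm (List.mem_reverse.1 hx)) p.reverse
    simpa using this
  · have := support_subset_of_isPath hG hr p.reverse hm
    simpa using this

end Graphs

/-! ### Separation by bags -/

/-- A bag that separates a bag containing `u` from a bag containing `v` in the tree meets every
walk from `u` to `v`. -/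
theorem TreeDecomposition.exists_mem_bag_of_walk {V N : Type u} {G : SimpleGraph V}
    (B : TreeDecomposition G N) {m : N} {u v : V} (w : G.Walk u v) {s t : N} (hu : u ∈ B.bag s)
    (hv : v ∈ B.bag t) (hm : ∀ p : B.tree.Walk s t, m ∈ p.support) :
    ∃ x ∈ w.support, x ∈ B.bag m := by
  have hpath : ∀ {y : V} {s t : N}, y ∈ B.bag s → y ∈ B.bag t →
      (∀ p : B.tree.Walk s t, m ∈ p.support) → y ∈ B.bag m := by
    intro y s t hs ht h
    obtain ⟨p, hp, -⟩ := B.isTree.existsUnique_path s t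
    exact B.path_condition s m t p hp (h p) ⟨hs, ht⟩
  induction w generalizing s with
  | nil => exact ⟨_, by simp, hpath hu hv hm⟩
  | @cons u u' v h w ih =>
    obtain ⟨r, hr, hr'⟩ := B.edge_covered u u' h
    -- If some walk from `s` to `r` avoids `m`, then `m` lies on every walk from `r` to `t`, and
    -- induction applies from `r`.
    by_cases h1 : ∀ p : B.tree.Walk s r, m ∈ p.support
    · exact ⟨u, by simp, hpath hu hr h1⟩
    · push Not at h1
      obtain ⟨p, hp⟩ := h1
      obtain ⟨x, hx, hxm⟩ := ih hr' hv fun q => by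
        have := hm (p.append q)
        rw [Walk.mem_support_append_iff] at this
        exact this.resolve_left hp
      exact ⟨x, by simp [hx], hxm⟩

theorem TreeDecomposition.edist_le_outerDiam {V N : Type u} {G : SimpleGraph V}
    (B : TreeDecomposition G N) {t : N} {u v : V} (hu : u ∈ B.bag t) (hv : v ∈ B.bag t) :
    G.edist u v ≤ B.outerDiam :=
  le_iSup_of_le t <| le_iSup₂_of_le u hu <| le_iSup₂_of_le v hv le_rfl

/-! ### Distances in the triangular lattice -/

section Triangle

variable {n : ℕ}

theorem triGraph_adj {p q : TriVertex n} : (triGraph n).Adj p q ↔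
    |(p.1.1 : ℤ) - q.1.1| + |(p.1.2.1 : ℤ) - q.1.2.1| + |(p.1.2.2 : ℤ) - q.1.2.2| = 2 :=
  Iff.rfl

theorem finite_triVertex (n : ℕ) : Finite (TriVertex n) := by
  refine Finite.of_injective (β := Fin (n + 1) × Fin (n + 1))
    (fun p => (⟨p.1.1, by have := p.2; omega⟩, ⟨p.1.2.1, by have := p.2; omega⟩)) ?_
  rintro ⟨⟨a, b, c⟩, h⟩ ⟨⟨a', b', c'⟩, h'⟩ heq
  simp only [Prod.mk.injEq, Fin.mk.injEq, Subtype.mk.injEq] at heq h h' ⊢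
  omega

/-- Distances in `triGraph n` are at most half the `ℓ¹`-distances. -/
theorem triGraph_edist_le {d : ℕ} : ∀ {p q : TriVertex n},
    |(p.1.1 : ℤ) - q.1.1| + |(p.1.2.1 : ℤ) - q.1.2.1| + |(p.1.2.2 : ℤ) - q.1.2.2| ≤ 2 * d →
    (triGraph n).edist p q ≤ d := by
  induction d with
  | zero =>
    rintro ⟨⟨a, b, c⟩, h⟩ ⟨⟨a', b', c'⟩, h'⟩ hd
    dsimp only at hd h h'
    obtain ⟨rfl, rfl, rfl⟩ : a = a' ∧ b = b' ∧ c = c' := by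
      simp only [abs_eq_max_neg] at hd
      omega
    simp
  | succ d ih =>
    intro p q hd
    by_cases hpq : p = q
    · simp [hpq]
    · obtain ⟨r, hpr, hrq⟩ : ∃ r : TriVertex n, (triGraph n).Adj p r ∧
          |(r.1.1 : ℤ) - q.1.1| + |(r.1.2.1 : ℤ) - q.1.2.1| + |(r.1.2.2 : ℤ) - q.1.2.2|
            ≤ 2 * d := by
        obtain ⟨⟨a, b, c⟩, h⟩ := p
        obtain ⟨⟨a', b', c'⟩, h'⟩ := q
        simp only [Subtype.mk.injEq, Prod.mk.injEq, not_and] at hpq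
        dsimp only at hd h h'
        simp only [triGraph_adj, abs_eq_max_neg] at hd ⊢
        obtain h1 | h1 | h1 | h1 | h1 | h1 : (a < a' ∧ b' < b) ∨ (a < a' ∧ c' < c) ∨
            (b < b' ∧ a' < a) ∨ (b < b' ∧ c' < c) ∨ (c < c' ∧ a' < a) ∨ (c < c' ∧ b' < b) := by
          omega
        · exact ⟨⟨(a + 1, b - 1, c), by dsimp only; omega⟩, by dsimp only; omega,
            by dsimp only; omega⟩
        · exact ⟨⟨(a + 1, b, c - 1), by dsimp only; omega⟩, by dsimp only; omega,
            by dsimp only; omega⟩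
        · exact ⟨⟨(a - 1, b + 1, c), by dsimp only; omega⟩, by dsimp only; omega,
            by dsimp only; omega⟩
        · exact ⟨⟨(a, b + 1, c - 1), by dsimp only; omega⟩, by dsimp only; omega,
            by dsimp only; omega⟩
        · exact ⟨⟨(a - 1, b, c + 1), by dsimp only; omega⟩, by dsimp only; omega,
            by dsimp only; omega⟩
        · exact ⟨⟨(a, b - 1, c + 1), by dsimp only; omega⟩, by dsimp only; omega,
            by dsimp only; omega⟩
      calc (triGraph n).edist p q ≤ (triGraph n).edist p r + (triGraph n).edist r q :=
            SimpleGraph.edist_triangle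
        _ ≤ 1 + d := add_le_add (edist_eq_one_iff_adj.2 hpr).le (ih hrq)
        _ = ((d + 1 : ℕ) : ℕ∞) := by push_cast; exact add_comm _ _

/-- If `k ≤ d(p, q)` then some coordinates of `p` and `q` differ by at least `k`. -/
theorem le_abs_sub_of_le_edist {k : ℕ} {p q : TriVertex n}
    (hk : (k : ℕ∞) ≤ (triGraph n).edist p q) :
    (k : ℤ) ≤ |(p.1.1 : ℤ) - q.1.1| ∨ (k : ℤ) ≤ |(p.1.2.1 : ℤ) - q.1.2.1| ∨
      (k : ℤ) ≤ |(p.1.2.2 : ℤ) - q.1.2.2| := by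
  by_contra! h
  have h1 := p.2
  have h2 := q.2
  -- Differences with sum zero have `ℓ¹`-norm twice the largest absolute value. For `k = 0`, `h` is
  -- already contradictory.
  have h3 : (triGraph n).edist p q ≤ (k - 1 : ℕ) := triGraph_edist_le (by
    simp only [abs_eq_max_neg] at h ⊢
    omega)
  have h4 : k ≤ k - 1 := by exact_mod_cast hk.trans h3
  simp only [abs_eq_max_neg] at h
  omega

/-- Along an edge of `triGraph n`, every coordinate changes by at most one. -/
theorem abs_sub_le_one_of_adj {p q : TriVertex n} (h : (triGraph n).Adj p q) :
    |(p.1.1 : ℤ) - q.1.1| ≤ 1 ∧ |(p.1.2.1 : ℤ) - q.1.2.1| ≤ 1 ∧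
      |(p.1.2.2 : ℤ) - q.1.2.2| ≤ 1 := by
  rw [triGraph_adj] at h
  have hp := p.2
  have hq := q.2
  simp only [abs_eq_max_neg] at h ⊢
  omega

/-! ### Geodesic cycles -/

/-- There is no closed sequence of length `L` of integer triples of constant sum, with coordinates
changing by at most one in every step, `2 ≤ k` and `2 * k ≤ L ≤ 2 * k + 1`, with the following
pairs of positions having some coordinates that differ by at least `k`: `0` and `k`; `1` and
`k + 1`; `k - 1` and `L - 1`. Here the first pair is realised by an increase of the first
coordinate. -/
theorem not_geodesic_closed_of_increase {L k : ℕ} (hk : 2 ≤ k) (hL : 2 * k ≤ L)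
    (hL' : L ≤ 2 * k + 1) {s : ℤ} {a b c : ℕ → ℤ} (hsum : ∀ i, a i + b i + c i = s)
    (hstep : ∀ i < L, |a i - a (i + 1)| ≤ 1 ∧ |b i - b (i + 1)| ≤ 1 ∧ |c i - c (i + 1)| ≤ 1)
    (ha : a L = a 0) (hb : b L = b 0) (hc : c L = c 0) (h0 : k ≤ a k - a 0)
    (h1 : k ≤ |a 1 - a (k + 1)| ∨ k ≤ |b 1 - b (k + 1)| ∨ k ≤ |c 1 - c (k + 1)|)
    (h2 : k ≤ |a (k - 1) - a (L - 1)| ∨ k ≤ |b (k - 1) - b (L - 1)| ∨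
      k ≤ |c (k - 1) - c (L - 1)|) : False := by
  simp only [le_abs] at h1 h2
  have lip : ∀ f : ℕ → ℤ, (∀ i < L, |f i - f (i + 1)| ≤ 1) → ∀ i j, i ≤ j → j ≤ L →
      f i - f j ≤ j - i ∧ f j - f i ≤ j - i := by
    intro f hf i j hij
    induction j, hij using Nat.le_induction with
    | base => simp
    | succ j hij ih =>
      intro hj
      have h := ih (by omega)
      have h' := abs_le.1 (hf j (by omega))
      push_cast
      omega
  have la := lip a fun i hi => (hstep i hi).1
  have lb := lip b fun i hi => (hstep i hi).2.1
  have lc := lip c fun i hi => (hstep i hi).2.2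
  have a01 := la 0 1 (by omega) (by omega)
  have a12 := la 1 2 (by omega) (by omega)
  have a2k := la 2 k (by omega) (by omega)
  obtain ⟨e1, e2, ek⟩ : a 1 = a 0 + 1 ∧ a 2 = a 0 + 2 ∧ a k = a 0 + k := by omega
  have sum1 := hsum 1
  have sumk := hsum k
  -- Otherwise another coordinate moves monotonically at every step from `1` to `k + 1`. It falls
  -- while `a` rises, so it falls together with `a` at the last step, and the third coordinate would
  -- jump by two.
  have forward : a k ≤ a (k + 1) := by
    have ak := la k (k + 1) (by omega) (by omega)
    have b12 := lb 1 2 (by omega) (by omega)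
    have b2k := lb 2 k (by omega) (by omega)
    have bk := lb k (k + 1) (by omega) (by omega)
    have c12 := lc 1 2 (by omega) (by omega)
    have c2k := lc 2 k (by omega) (by omega)
    have ck := lc k (k + 1) (by omega) (by omega)
    have sum2 := hsum 2
    have sumk' := hsum (k + 1)
    push_cast at *
    omega
  -- The same argument on the `k` steps from `L - 1` through `L`, identified with `0`, to `k - 1`.
  have backward : a (L - 1) ≤ a 0 := by
    obtain ⟨m, rfl⟩ : ∃ m, k = m + 2 := ⟨k - 2, by omega⟩
    obtain ⟨l, rfl⟩ : ∃ l, L = l + 1 := ⟨L - 1, by omega⟩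
    simp only [Nat.add_sub_cancel, show m + 2 - 1 = m + 1 by omega] at *
    have am := la 0 m (by omega) (by omega)
    have bm := lb 0 m (by omega) (by omega)
    have cm := lc 0 m (by omega) (by omega)
    have am' := la m (m + 1) (by omega) (by omega)
    have bm' := lb m (m + 1) (by omega) (by omega)
    have cm' := lc m (m + 1) (by omega) (by omega)
    have am'' := la (m + 1) (m + 2) (by omega) (by omega)
    have al := la l (l + 1) (by omega) (by omega)
    have bl := lb l (l + 1) (by omega) (by omega)
    have cl := lc l (l + 1) (by omega) (by omega)
    have sum0 := hsum 0
    have summ := hsum m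
    have summ' := hsum (m + 1)
    have suml := hsum l
    push_cast at *
    omega
  have := la (k + 1) (L - 1) (by omega) (by omega)
  push_cast [show 1 ≤ L by omega] at this
  omega

/-- The symmetric form of `not_geodesic_closed_of_increase`. -/
theorem not_geodesic_closed {L k : ℕ} (hk : 2 ≤ k) (hL : 2 * k ≤ L) (hL' : L ≤ 2 * k + 1)
    {s : ℤ} {a b c : ℕ → ℤ} (hsum : ∀ i, a i + b i + c i = s)
    (hstep : ∀ i < L, |a i - a (i + 1)| ≤ 1 ∧ |b i - b (i + 1)| ≤ 1 ∧ |c i - c (i + 1)| ≤ 1)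
    (ha : a L = a 0) (hb : b L = b 0) (hc : c L = c 0)
    (h0 : k ≤ |a 0 - a k| ∨ k ≤ |b 0 - b k| ∨ k ≤ |c 0 - c k|)
    (h1 : k ≤ |a 1 - a (k + 1)| ∨ k ≤ |b 1 - b (k + 1)| ∨ k ≤ |c 1 - c (k + 1)|)
    (h2 : k ≤ |a (k - 1) - a (L - 1)| ∨ k ≤ |b (k - 1) - b (L - 1)| ∨
      k ≤ |c (k - 1) - c (L - 1)|) : False := by
  have first : ∀ {s : ℤ} {a b c : ℕ → ℤ}, (∀ i, a i + b i + c i = s) →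
      (∀ i < L, |a i - a (i + 1)| ≤ 1 ∧ |b i - b (i + 1)| ≤ 1 ∧ |c i - c (i + 1)| ≤ 1) →
      a L = a 0 → b L = b 0 → c L = c 0 → k ≤ |a 0 - a k| →
      (k ≤ |a 1 - a (k + 1)| ∨ k ≤ |b 1 - b (k + 1)| ∨ k ≤ |c 1 - c (k + 1)|) →
      (k ≤ |a (k - 1) - a (L - 1)| ∨ k ≤ |b (k - 1) - b (L - 1)| ∨
        k ≤ |c (k - 1) - c (L - 1)|) → False := by
    intro s a b c hsum hstep ha hb hc h0 h1 h2
    have habs : ∀ x y : ℤ, |-x - -y| = |x - y| := fun x y => by rw [← abs_neg]; congr 1; ring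
    rcases le_abs.1 h0 with h | h
    · exact not_geodesic_closed_of_increase hk hL hL' (s := -s) (a := fun i => -a i)
        (b := fun i => -b i) (c := fun i => -c i) (fun i => by linarith [hsum i])
        (by simpa only [habs] using hstep) (by simpa using ha) (by simpa using hb)
        (by simpa using hc) (by linarith) (by simpa only [habs] using h1)
        (by simpa only [habs] using h2)
    · exact not_geodesic_closed_of_increase hk hL hL' hsum hstep ha hb hc (by linarith) h1 h2
  rcases h0 with h | h | h
  · exact first hsum hstep ha hb hc h h1 h2
  · exact first (s := s) (fun i => by linarith [hsum i])
      (fun i hi => have h := hstep i hi; ⟨h.2.1, h.1, h.2.2⟩) hb ha hc h (by tauto) (by tauto)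
  · exact first (s := s) (fun i => by linarith [hsum i])
      (fun i hi => have h := hstep i hi; ⟨h.2.2, h.1, h.2.1⟩) hc ha hb h (by tauto) (by tauto)

theorem length_eq_three_of_isGeodesicCycle {v : TriVertex n} {w : (triGraph n).Walk v v}
    (hw : IsGeodesicCycle w) : w.length = 3 := by
  obtain ⟨hc, -, hgeo⟩ := hw
  have h3 := hc.three_le_length
  by_contra hne
  have hmem : ∀ i, w.getVert i ∈ w.toSubgraph.verts := fun i => by
    rw [Walk.mem_verts_toSubgraph]
    exact w.getVert_mem_support i
  have hfar : ∀ i j, i ≤ j → j < w.length → w.length / 2 ≤ j - i →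
      w.length / 2 + j ≤ w.length + i →
      ((w.length / 2 : ℕ) : ℕ∞) ≤ (triGraph n).edist (w.getVert i) (w.getVert j) := by
    intro i j hij hj h1 h2
    rw [← hgeo ⟨_, hmem i⟩ ⟨_, hmem j⟩]
    exact le_edist_toSubgraph_of_isCycle hc hj h1 h2 hij _ _
  refine not_geodesic_closed (L := w.length) (k := w.length / 2) (s := n)
    (a := fun i => ((w.getVert i).1.1 : ℤ)) (b := fun i => ((w.getVert i).1.2.1 : ℤ))
    (c := fun i => ((w.getVert i).1.2.2 : ℤ)) (by omega) (by omega) (by omega)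
    (fun i => ?_) (fun i hi => abs_sub_le_one_of_adj (w.adj_getVert_succ hi)) (by simp) (by simp) (by simp)
    (le_abs_sub_of_le_edist (hfar _ _ ?_ ?_ ?_ ?_))
    (le_abs_sub_of_le_edist (hfar _ _ ?_ ?_ ?_ ?_))
    (le_abs_sub_of_le_edist (hfar _ _ ?_ ?_ ?_ ?_))
  · exact_mod_cast (w.getVert i).2
  all_goals omega

/-! ### Lower bound on tree-length -/

/-- Every tree-decomposition of `triGraph n` has a bag that meets all three sides. -/
theorem exists_bag_meeting_sides {N : Type} (B : TreeDecomposition (triGraph n) N) :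
    ∃ t, ∃ x ∈ B.bag t, ∃ y ∈ B.bag t, ∃ z ∈ B.bag t,
      x.1.1 = 0 ∧ y.1.2.1 = 0 ∧ z.1.2.2 = 0 := by
  have side : ∀ f : ℕ → ℕ × ℕ × ℕ, (hf : ∀ i ≤ n, (f i).1 + (f i).2.1 + (f i).2.2 = n) →
      (∀ i < n, |((f i).1 : ℤ) - (f (i + 1)).1| + |((f i).2.1 : ℤ) - (f (i + 1)).2.1| +
        |((f i).2.2 : ℤ) - (f (i + 1)).2.2| = 2) →
      ∃ p : (triGraph n).Walk ⟨f 0, hf 0 (by omega)⟩ ⟨f n, hf n le_rfl⟩,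
        ∀ v ∈ p.support, ∃ i, v.1 = f i := by
    intro f hf hadj
    obtain ⟨p, hp⟩ := exists_walk_of_adj_succ (G := triGraph n)
      -- Capping the index at `n` keeps the coordinate sum equal to `n` for every `i`.
      (fun i => ⟨f (min i n), hf _ (by omega)⟩) n (fun i hi => by
        rw [triGraph_adj]
        dsimp only
        rw [min_eq_left (by omega), min_eq_left (by omega)]
        exact hadj i hi)
    refine ⟨p.copy (by simp) (by simp), fun v hv => ?_⟩
    rw [Walk.support_copy] at hv
    obtain ⟨i, -, rfl⟩ := hp v hv
    exact ⟨_, rfl⟩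
  obtain ⟨pab, hab⟩ := side (fun i => (n - i, i, 0)) (fun i hi => by dsimp only; omega)
    (fun i hi => by simp only [abs_eq_max_neg]; omega)
  obtain ⟨pbc, hbc⟩ := side (fun i => (0, n - i, i)) (fun i hi => by dsimp only; omega)
    (fun i hi => by simp only [abs_eq_max_neg]; omega)
  obtain ⟨pca, hca⟩ := side (fun i => (i, 0, n - i)) (fun i hi => by dsimp only; omega)
    (fun i hi => by simp only [abs_eq_max_neg]; omega)
  obtain ⟨ta, hta⟩ := B.vertex_covered ⟨(n, 0, 0), by simp⟩
  obtain ⟨tb, htb⟩ := B.vertex_covered ⟨(0, n, 0), by simp⟩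
  obtain ⟨tc, htc⟩ := B.vertex_covered ⟨(0, 0, n), by simp⟩
  obtain ⟨m, mab, mbc, mca⟩ := exists_median B.isTree ta tb tc
  obtain ⟨x, hx, hxm⟩ := B.exists_mem_bag_of_walk pbc (by simpa using htb) (by simpa using htc) mbc
  obtain ⟨y, hy, hym⟩ := B.exists_mem_bag_of_walk pca (by simpa using htc) (by simpa using hta) mca
  obtain ⟨z, hz, hzm⟩ := B.exists_mem_bag_of_walk pab (by simpa using hta) (by simpa using htb) mab
  refine ⟨m, x, hxm, y, hym, z, hzm, ?_, ?_, ?_⟩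
  · obtain ⟨i, hi⟩ := hbc x hx
    rw [hi]
  · obtain ⟨i, hi⟩ := hca y hy
    rw [hi]
  · obtain ⟨i, hi⟩ := hab z hz
    rw [hi]

/-- The tree-length of `triGraph n` is at least `n / 2`. -/
theorem le_odw_triGraph {k : ℕ} (hk : 2 * k ≤ n + 1) : (k : ℕ∞) ≤ odw (triGraph n) := by
  refine le_iInf₂ fun N B => ?_
  obtain ⟨t, x, hx, y, hy, z, hz, hx0, hy0, hz0⟩ := exists_bag_meeting_sides B
  have hsum := x.2
  -- Since `x` has first coordinate zero, its other two sum to `n ≥ 2 * k - 1`, so one of them is at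
  -- least `k`.
  rcases Nat.lt_or_ge x.1.2.1 k with h | h
  · refine le_trans ?_ (B.edist_le_outerDiam hx hz)
    refine le_edist_of_le_abs_sub (f := fun p => (p.1.2.2 : ℤ))
      (fun p q hpq => (abs_sub_le_one_of_adj hpq).2.2) (le_abs.2 ?_)
    omega
  · refine le_trans ?_ (B.edist_le_outerDiam hx hy)
    refine le_edist_of_le_abs_sub (f := fun p => (p.1.2.1 : ℤ))
      (fun p q hpq => (abs_sub_le_one_of_adj hpq).2.1) (le_abs.2 ?_)
    omega

end Triangle

end TreeLength

theorem theorem2p5 :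
    -- the triangular pieces of the triangular lattice
    (∀ n : ℕ,
      Finite (TreeLength.TriVertex n) ∧
      (∀ (v : TreeLength.TriVertex n) (c : (TreeLength.triGraph n).Walk v v),
        TreeLength.IsGeodesicCycle c → c.length = 3) ∧
      (n : ℕ∞) ≤ 3 * TreeLength.odw (TreeLength.triGraph n)) ∧
    -- finite graphs with arbitrarily large tree-length, all geodesic cycles of length three
    (∀ k : ℕ, ∃ (V : Type) (G : SimpleGraph V),
      Finite V ∧
      (∀ (v : V) (c : G.Walk v v), TreeLength.IsGeodesicCycle c → c.length = 3) ∧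
      (k : ℕ∞) ≤ TreeLength.odw G) ∧
    -- bounding the length of geodesic cycles does not bound tree-length
    (¬ ∃ f : ℕ → ℕ, ∀ (V : Type) (G : SimpleGraph V) (l : ℕ), Finite V →
      (∀ (v : V) (c : G.Walk v v), TreeLength.IsGeodesicCycle c → c.length ≤ l) →
      TreeLength.odw G ≤ (f l : ℕ∞)) := by
  have geo : ∀ (n : ℕ) (v : TreeLength.TriVertex n) (c : (TreeLength.triGraph n).Walk v v),
      TreeLength.IsGeodesicCycle c → c.length = 3 :=
    fun n v c hc => TreeLength.length_eq_three_of_isGeodesicCycle hc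
  refine ⟨fun n => ⟨TreeLength.finite_triVertex n, geo n, ?_⟩, fun k => ?_, ?_⟩
  · calc (n : ℕ∞) ≤ ((3 * ((n + 1) / 2) : ℕ) : ℕ∞) := by
          exact_mod_cast (by omega : n ≤ 3 * ((n + 1) / 2))
      _ = 3 * (((n + 1) / 2 : ℕ) : ℕ∞) := by rw [Nat.cast_mul]; rfl
      _ ≤ 3 * TreeLength.odw (TreeLength.triGraph n) :=
        mul_le_mul_right (TreeLength.le_odw_triGraph (by omega)) 3
  · exact ⟨TreeLength.TriVertex (2 * k), TreeLength.triGraph (2 * k),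
      TreeLength.finite_triVertex _, geo _, TreeLength.le_odw_triGraph (by omega)⟩
  · rintro ⟨f, hf⟩
    have h1 := hf _ (TreeLength.triGraph (2 * (f 3 + 1))) 3 (TreeLength.finite_triVertex _)
      fun v c hc => (geo _ v c hc).le
    have h2 : ((f 3 + 1 : ℕ) : ℕ∞) ≤ f 3 := (TreeLength.le_odw_triGraph (by omega)).trans h1
    have h3 : f 3 + 1 ≤ f 3 := by exact_mod_cast h2
    omega
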